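/- Let $A \subset \mathbb{R}^d$ be a finite set with at least two points and let $C = \operatorname{conv}(A)$. For a finite set $B$ and $r\neq 0$ let $\operatorname{dirW}(B,r)=\max_{s,v\in B}\langle r/\|r\|, s-v\rangle$, and let $\operatorname{width}(B)$ be the infimum of $\operatorname{dirW}(B,r)$ over the nonzero directions $r$ parallel to the affine hull of $B$. Define - $\operatorname{minwidth}(A)=\min\{\operatorname{width}(S) : S\subseteq A,\ |S|\ge 2\}$; - $\operatorname{PDirW}(B,r,x)=\min_{S}\max_{s\in B,\,v\in S}\langle r/\|r\|,s-v\rangle$, where $S$ runs over the sets $S\subseteq B$ such that $x$ is a convex combination, with all coefficients positive, of all the elements of $S$; - $\operatorname{PWidth}(A)=\min \operatorname{PDirW}(K\cap A,r,x)$ over all faces $K$ of $C$, all $x\in K$ and all $r\in\operatorname{cone}(K-x)\setminus\{0\}$ (pyramidal width); - $\Phi(C)=\min_F d\bigl(F,\operatorname{conv}(\operatorname{vertices}(C)\setminus F)\bigr)$ and $\Phi_A=\min_F d\bigl(F,\operatorname{conv}(A\setminus F)\bigr)$, over all faces $F$ of $C$ with $\emptyset\subsetneq F\subsetneq C$ (the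 facial distance of $C$, and the facial distance with respect to the set $A$ of atoms; they coincide if $A=\operatorname{vertices}(C)$); - $\operatorname{vf}(C)=\min_F d\bigl(\operatorname{aff}(F),\operatorname{vertices}(C)\setminus F\bigr)$ over all facets $F$ of $C$ (vertex-facet distance). Then \[ \operatorname{minwidth}(A)\le \Phi_A=\operatorname{PWidth}(A)\le \Phi(\operatorname{conv} A)\le \operatorname{vf}(\operatorname{conv} A). \] If moreover $A$ is the set of vertices of $\operatorname{conv}(A)$, then $\Phi(\operatorname{conv} A)=\operatorname{PWidth}(A)$, so that \[ \operatorname{minwidth}(A)\le \Phi(\operatorname{conv} A)=\operatorname{PWidth}(A)\le \operatorname{vf}(\operatorname{conv} A). \] -/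

import Mathlib

/-- Distance between two (nonempty) sets: the infimum of the pairwise distances. -/
noncomputable def setDist {d : ℕ} (s t : Set (EuclideanSpace ℝ (Fin d))) : ℝ :=
  sInf {δ : ℝ | ∃ x ∈ s, ∃ y ∈ t, δ = dist x y}

/-- Directional width `sup_{s, v ∈ A} ⟨r / ‖r‖, s - v⟩` of `A` in direction `r`. -/
noncomputable def dirWidth {d : ℕ} (A : Set (EuclideanSpace ℝ (Fin d)))
    (r : EuclideanSpace ℝ (Fin d)) : ℝ :=
  sSup {t : ℝ | ∃ s ∈ A, ∃ v ∈ A, t = inner ℝ (‖r‖⁻¹ • r) (s - v)}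

/-- Width of `A`: infimum of the directional widths over all nonzero directions parallel to the
affine hull of `A`. It is meaningful for sets with at least two points; a one-point set has no
such direction. -/
noncomputable def setWidth {d : ℕ} (A : Set (EuclideanSpace ℝ (Fin d))) : ℝ :=
  sInf {t : ℝ | ∃ r : EuclideanSpace ℝ (Fin d),
    r ∈ (affineSpan ℝ A).direction ∧ r ≠ 0 ∧ t = dirWidth A r}

/-- Minimum width over the subsets of `A` with at least two points. The empty set and singletons
have no directions in their affine hulls, so they do not take part in the minimum. -/
noncomputable def minwidth {d : ℕ} (A : Set (EuclideanSpace ℝ (Fin d))) : ℝ :=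
  sInf {t : ℝ | ∃ S : Set (EuclideanSpace ℝ (Fin d)), S ⊆ A ∧ S.Nontrivial ∧ t = setWidth S}

/-- `x` is a proper convex combination of all the elements of the finite set `T`: all the
coefficients are positive. -/
def IsProperConvexCombination {d : ℕ} (T : Finset (EuclideanSpace ℝ (Fin d)))
    (x : EuclideanSpace ℝ (Fin d)) : Prop :=
  ∃ w : EuclideanSpace ℝ (Fin d) → ℝ,
    (∀ v ∈ T, 0 < w v) ∧ ∑ v ∈ T, w v = 1 ∧ ∑ v ∈ T, w v • v = x

/-- Pyramidal directional width: `min_S max_{s ∈ A, v ∈ S} ⟨r / ‖r‖, s - v⟩`, where `S` runs over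
the subsets of `A` such that `x` is a proper convex combination of all the elements of `S`. -/
noncomputable def pyrDirWidth {d : ℕ} (A : Set (EuclideanSpace ℝ (Fin d)))
    (r x : EuclideanSpace ℝ (Fin d)) : ℝ :=
  sInf {t : ℝ | ∃ S : Finset (EuclideanSpace ℝ (Fin d)),
    (S : Set (EuclideanSpace ℝ (Fin d))) ⊆ A ∧ IsProperConvexCombination S x ∧
    t = sSup {u : ℝ | ∃ s ∈ A, ∃ v ∈ S, u = inner ℝ (‖r‖⁻¹ • r) (s - v)}}

/-- Pyramidal width of `A`: the smallest pyramidal directional width of `K ∩ A`, over the faces `K`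
of `conv A`, the base points `x ∈ K` and the nonzero directions `r` in the cone generated by
`K - x`. -/
noncomputable def pyrWidth {d : ℕ} (A : Set (EuclideanSpace ℝ (Fin d))) : ℝ :=
  sInf {t : ℝ | ∃ (K : Set (EuclideanSpace ℝ (Fin d))) (x r : EuclideanSpace ℝ (Fin d)),
    IsExposed ℝ (convexHull ℝ A) K ∧ x ∈ K ∧
    r ∈ PointedCone.hull ℝ ((fun y => y - x) '' K) ∧ r ≠ 0 ∧
    t = pyrDirWidth (K ∩ A) r x}

/-- `F` is a nonempty proper face of the polytope `C`. -/
def IsProperFace {d : ℕ} (C F : Set (EuclideanSpace ℝ (Fin d))) : Prop :=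
  IsExposed ℝ C F ∧ F.Nonempty ∧ F ≠ C

/-- `F` is a facet of the polytope `C` of dimension at least one: a nonempty face whose dimension
is one less than the dimension of `C`. -/
def IsFacet {d : ℕ} (C F : Set (EuclideanSpace ℝ (Fin d))) : Prop :=
  IsExposed ℝ C F ∧ F.Nonempty ∧
    Module.finrank ℝ (affineSpan ℝ F).direction + 1 = Module.finrank ℝ (affineSpan ℝ C).direction

/-- Facial distance of the polytope `C`: the minimum over the nonempty proper faces `F` of the
distance from `F` to the convex hull of the vertices that are not in `F`. -/
noncomputable def facialDist {d : ℕ} (C : Set (EuclideanSpace ℝ (Fin d))) : ℝ :=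
  sInf {t : ℝ | ∃ F : Set (EuclideanSpace ℝ (Fin d)), IsProperFace C F ∧
    t = setDist F (convexHull ℝ (C.extremePoints ℝ \ F))}

/-- Facial distance of the finite set `A` of atoms: the same quantity for `conv A`, with the atoms
in place of the vertices. -/
noncomputable def atomicFacialDist {d : ℕ} (A : Set (EuclideanSpace ℝ (Fin d))) : ℝ :=
  sInf {t : ℝ | ∃ F : Set (EuclideanSpace ℝ (Fin d)), IsProperFace (convexHull ℝ A) F ∧
    t = setDist F (convexHull ℝ (A \ F))}

/-- Vertex-facet distance of the polytope `P`: the minimum over the facets `F` of the distance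
between the affine hull of `F` and the set of vertices that are not in `F`. -/
noncomputable def vertexFacetDist {d : ℕ} (P : Set (EuclideanSpace ℝ (Fin d))) : ℝ :=
  sInf {t : ℝ | ∃ F : Set (EuclideanSpace ℝ (Fin d)), IsFacet P F ∧
    t = setDist (affineSpan ℝ F : Set (EuclideanSpace ℝ (Fin d))) (P.extremePoints ℝ \ F)}

/-! ### Farkas' lemma, exposed faces of polytopes, exits of rays. -/

section Polytopes

variable {E : Type*} [NormedAddCommGroup E]

/-! The core is `IsExposed.exists_properFace_of_ray`. If a ray in direction `r` leaves a point of
`conv S` inside a face `K`, look at its last point `t • r = u - z` in the difference body `conv (K ∩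
A) - conv S`. A functional supporting the body there is maximal on `K` at `u` and minimal on `conv
S` at `z`. Its maximizers in `K` form a proper face containing `u`, while `z` is a combination of
atoms off that face. So the facial distance is at most `‖u - z‖`, the component of `u - z` along
`r`, hence at most the extent in direction `r`. This bounds it by the pyramidal width.

Conversely, a nearest pair `u`, `z` of a face `F` and `conv (A \ F)` spans a slab normal to `u - z`
(`IsProperFace.exists_nearest`). The atoms on its two walls form a subset of width at most `‖u -
z‖`, which handles `minwidth`. For the pyramidal width, `F` is shrunk until all its atoms lie on the
wall through `u`.

Passing from atoms to vertices only shrinks `conv (A \ F)`. For the vertex-facet distance, the ray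
statement is applied with `r` running from a vertex to its projection on the affine hull of the
facet. -/

/-- **Farkas' lemma** for finitely many vectors. -/
theorem farkas_finset [NormedSpace ℝ E] {ι : Type*} (s : Finset ι) (a : ι → E) (p : E)
    (h : ∀ l : StrongDual ℝ E, (∀ i ∈ s, l (a i) ≤ 0) → l p ≤ 0) :
    ∃ c : ι → ℝ, (∀ i ∈ s, 0 ≤ c i) ∧ ∑ i ∈ s, c i • a i = p := by
  classical
  induction s using Finset.induction_on generalizing a p with
  | empty =>
    refine ⟨0, by simp, ?_⟩
    by_contra hp
    have hp0 : p ≠ 0 := fun h0 => hp (by simp [h0])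
    have h0 : 0 < ‖p‖ := norm_pos_iff.2 hp0
    obtain ⟨l, -, hl⟩ := exists_dual_vector ℝ p h0.ne'
    have := h l (by simp)
    rw [hl] at this
    exact absurd this (by simpa using h0)
  | insert j s hj ih =>
    by_cases hs : ∀ l : StrongDual ℝ E, (∀ i ∈ s, l (a i) ≤ 0) → l p ≤ 0
    · obtain ⟨c, hc, hcp⟩ := ih a p hs
      refine ⟨Function.update c j 0, fun i hi => ?_, ?_⟩
      · by_cases hij : i = j
        · simp [hij]
        · simpa [hij] using hc i (Finset.mem_of_mem_insert_of_ne hi hij)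
      · rw [Finset.sum_insert hj, ← hcp]
        simp only [Function.update_self, zero_smul, zero_add]
        refine Finset.sum_congr rfl fun i hi => ?_
        rw [Function.update_of_ne (ne_of_mem_of_not_mem hi hj)]
    · push Not at hs
      obtain ⟨l, hl, hlp⟩ := hs
      have hlj : 0 < l (a j) := by
        by_contra! hcon
        refine absurd (h l fun i hi => ?_) hlp.not_ge
        rcases Finset.mem_insert.1 hi with rfl | hi
        · exact hcon
        · exact hl i hi
      -- `x ↦ x - μ x • a j` is the projection onto `ker l` along `a j`; the induction hypothesis is
      -- applied to the projected vectors.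
      set μ : E → ℝ := fun x => l x / l (a j) with hμ
      obtain ⟨c, hc, hcp⟩ := ih (fun i => a i - μ (a i) • a j) (p - μ p • a j) (by
        intro m hm
        have key : ∀ x, (m - (m (a j) / l (a j)) • l) x = m (x - μ x • a j) := by
          intro x
          simp [hμ]
          field_simp
        rw [← key]
        refine h _ fun i hi => ?_
        rw [key]
        rcases Finset.mem_insert.1 hi with rfl | hi
        · simp [hμ, hlj.ne']
        · exact hm i hi)
      have hμs : ∀ i ∈ s, μ (a i) ≤ 0 := fun i hi => div_nonpos_of_nonpos_of_nonneg (hl i hi) hlj.le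
      -- Undoing the projection forces this coefficient of `a j`. It is nonnegative because `μ p >
      -- 0` and `μ ≤ 0` on the other vectors.
      refine ⟨Function.update c j (μ p - ∑ i ∈ s, c i * μ (a i)), fun i hi => ?_, ?_⟩
      · by_cases hij : i = j
        · subst hij
          have h1 : 0 ≤ μ p := (div_pos hlp hlj).le
          have h2 : ∑ k ∈ s, c k * μ (a k) ≤ 0 :=
            Finset.sum_nonpos fun k hk => mul_nonpos_of_nonneg_of_nonpos (hc k hk) (hμs k hk)
          simp only [Function.update_self]
          linarith
        · simpa [hij] using hc i (Finset.mem_of_mem_insert_of_ne hi hij)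
      · rw [Finset.sum_insert hj]
        have h1 : ∑ i ∈ s, Function.update c j (μ p - ∑ i ∈ s, c i * μ (a i)) i • a i
            = ∑ i ∈ s, c i • a i := Finset.sum_congr rfl fun i hi => by
          rw [Function.update_of_ne (ne_of_mem_of_not_mem hi hj)]
        rw [h1, Function.update_self, sub_smul, Finset.sum_smul]
        simp only [smul_sub, Finset.sum_sub_distrib, smul_smul] at hcp
        rw [sub_eq_sub_iff_add_eq_add] at hcp
        rw [sub_add_eq_add_sub, sub_eq_iff_eq_add, add_comm, hcp]

theorem le_of_mem_convexHull [NormedSpace ℝ E] {A : Set E} {l : StrongDual ℝ E} {α : ℝ}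
    (h : ∀ a ∈ A, l a ≤ α) {z : E} (hz : z ∈ convexHull ℝ A) : l z ≤ α :=
  convexHull_min (t := {z | l z ≤ α}) h (convex_halfSpace_le l.isLinear α) hz

open scoped Pointwise in
theorem sub_le_of_mem_convexHull [NormedSpace ℝ E] {A B : Set E} {l : StrongDual ℝ E} {α : ℝ}
    (h : ∀ a ∈ A, ∀ b ∈ B, l (a - b) ≤ α) {u z : E} (hu : u ∈ convexHull ℝ A)
    (hz : z ∈ convexHull ℝ B) : l (u - z) ≤ α := by
  refine le_of_mem_convexHull (A := A - B) ?_ ((convexHull_sub (R := ℝ) A B).ge (Set.sub_mem_sub hu hz))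
  rintro _ ⟨a, ha, b, hb, rfl⟩
  exact h a ha b hb

/-- A point of a convex hull where a functional attains its maximum lies in the convex hull of the
maximizing generators. -/
theorem mem_convexHull_maximizers [NormedSpace ℝ E] {A : Set E} {l : StrongDual ℝ E} {α : ℝ}
    (h : ∀ a ∈ A, l a ≤ α) {z : E} (hz : z ∈ convexHull ℝ A) (hα : α ≤ l z) :
    z ∈ convexHull ℝ {a ∈ A | l a = α} := by
  set A₁ := {a ∈ A | l a = α}
  set A₂ := {a ∈ A | l a < α}
  have hA : A = A₁ ∪ A₂ := by
    ext a
    constructor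
    · intro ha
      rcases (h a ha).eq_or_lt with h' | h'
      exacts [Or.inl ⟨ha, h'⟩, Or.inr ⟨ha, h'⟩]
    · rintro (ha | ha) <;> exact ha.1
  have hlt : ∀ y ∈ convexHull ℝ A₂, l y < α := fun y hy =>
    convexHull_min (t := {z | l z < α}) (fun a ha => ha.2) (convex_halfSpace_lt l.isLinear α) hy
  rcases A₂.eq_empty_or_nonempty with h2 | h2
  · rwa [hA, h2, Set.union_empty] at hz
  rcases A₁.eq_empty_or_nonempty with h1 | h1
  · rw [hA, h1, Set.empty_union] at hz
    exact absurd (hlt z hz) hα.not_gt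
  rw [hA, convexHull_union h1 h2, mem_convexJoin] at hz
  obtain ⟨x, hx, y, hy, s, t, hs, ht, hst, rfl⟩ := hz
  have hxα : l x ≤ α := le_of_mem_convexHull (fun a ha => ha.2.le) hx
  have hyα := hlt y hy
  have ht0 : t = 0 := by
    by_contra hne
    have htp : 0 < t := lt_of_le_of_ne ht (Ne.symm hne)
    simp only [map_add, map_smul, smul_eq_mul] at hα
    have e : α = s * α + t * α := by rw [← add_mul, hst, one_mul]
    nlinarith [mul_le_mul_of_nonneg_left hxα hs, mul_lt_mul_of_pos_left hyα htp]
  have hs1 : s = 1 := by linarith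
  simpa [ht0, hs1] using hx

theorem IsExposed.eq_convexHull_inter [NormedSpace ℝ E] {A K : Set E}
    (hK : IsExposed ℝ (convexHull ℝ A) K) : K = convexHull ℝ (K ∩ A) := by
  refine Set.Subset.antisymm (fun x hx => ?_)
    (convexHull_min Set.inter_subset_left (hK.convex (convex_convexHull ℝ A)))
  obtain ⟨l, hl⟩ := hK ⟨x, hx⟩
  have hx' := hx
  rw [hl] at hx'
  refine convexHull_mono ?_ (mem_convexHull_maximizers
    (fun a ha => hx'.2 a (subset_convexHull ℝ A ha)) hx'.1 le_rfl)
  rintro a ⟨ha, hax⟩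
  refine ⟨?_, ha⟩
  rw [hl]
  exact ⟨subset_convexHull ℝ A ha, fun y hy => hax ▸ hx'.2 y hy⟩

/-- An exposed face of an exposed face of a polytope is an exposed face of the polytope. -/
theorem IsExposed.trans_convexHull [NormedSpace ℝ E] {A K G : Set E} (hfin : A.Finite)
    (hK : IsExposed ℝ (convexHull ℝ A) K) (hG : IsExposed ℝ K G) :
    IsExposed ℝ (convexHull ℝ A) G := by
  rintro ⟨g, hg⟩
  have hgK : g ∈ K := hG.subset hg
  have hGconv : Convex ℝ G := hG.convex (hK.convex (convex_convexHull ℝ A))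
  obtain ⟨l, hl⟩ := hK ⟨g, hgK⟩
  obtain ⟨m, hm⟩ := hG ⟨g, hg⟩
  have hlg : ∀ y ∈ convexHull ℝ A, l y ≤ l g := by rw [hl] at hgK; exact hgK.2
  have hmg : ∀ y ∈ K, m y ≤ m g := by rw [hm] at hg; exact hg.2
  have hKmem : ∀ y ∈ convexHull ℝ A, l y = l g → y ∈ K := fun y hy h => by
    rw [hl]; exact ⟨hy, fun w hw => h ▸ hlg w hw⟩
  have hKeq : ∀ y ∈ K, l y = l g := fun y hy => by
    rw [hl] at hy
    exact le_antisymm (hlg y hy.1) (hy.2 g (hK.subset hgK))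
  -- On each of the finitely many atoms off `K`, `l` is strictly below its maximum, so a large
  -- weight `M` outweighs whatever `m` gains there.
  obtain ⟨M, hM⟩ : ∃ M : ℝ, ∀ a ∈ A, a ∉ K → m a + M * l a < m g + M * l g := by
    refine (((Filter.eventually_all_finite hfin).2 fun a ha => ?_) :
      ∀ᶠ M : ℝ in Filter.atTop, ∀ a ∈ A, a ∉ K → m a + M * l a < m g + M * l g).exists
    by_cases haK : a ∈ K
    · exact Filter.Eventually.of_forall fun _ h => absurd haK h
    have haA := subset_convexHull ℝ A ha
    have hlt : 0 < l g - l a :=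
      sub_pos.2 (lt_of_le_of_ne (hlg a haA) fun h => haK (hKmem a haA h))
    filter_upwards [Filter.eventually_gt_atTop ((m a - m g) / (l g - l a))] with M hM _
    rw [div_lt_iff₀ hlt] at hM
    linarith
  have hfA : ∀ a ∈ A, (m + M • l) a ≤ (m + M • l) g := by
    intro a ha
    simp only [add_apply, smul_apply, smul_eq_mul]
    by_cases haK : a ∈ K
    · rw [hKeq a haK]
      linarith [hmg a haK]
    · exact (hM a ha haK).le
  refine ⟨m + M • l, Set.Subset.antisymm (fun x hx => ?_) fun x hx => ?_⟩
  · have hxK := hG.subset hx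
    refine ⟨hK.subset hxK, fun y hy => (le_of_mem_convexHull hfA hy).trans ?_⟩
    have : m g ≤ m x := by rw [hm] at hx; exact hx.2 g hgK
    simp only [add_apply, smul_apply, smul_eq_mul]
    rw [hKeq x hxK]
    linarith
  · refine convexHull_min ?_ hGconv
      (mem_convexHull_maximizers hfA hx.1 (hx.2 g (hK.subset hgK)))
    rintro a ⟨ha, hag⟩
    simp only [add_apply, smul_apply, smul_eq_mul] at hag
    have haK : a ∈ K := by
      by_contra haK
      exact (hM a ha haK).ne hag
    rw [hKeq a haK] at hag
    rw [hm]
    exact ⟨haK, fun y hy => (hmg y hy).trans (by linarith)⟩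

/-- Krein–Milman; the closure is superfluous because the vertices are finitely many. -/
theorem convexHull_extremePoints_convexHull [NormedSpace ℝ E] {A : Set E} (hfin : A.Finite) :
    convexHull ℝ ((convexHull ℝ A).extremePoints ℝ) = convexHull ℝ A := by
  have hV : ((convexHull ℝ A).extremePoints ℝ).Finite := hfin.subset extremePoints_convexHull_subset
  rw [← (hV.isClosed_convexHull ℝ).closure_eq]
  exact closure_convexHull_extremePoints (hfin.isCompact_convexHull ℝ) (convex_convexHull ℝ A)

/-- The last point in which a ray meets a polytope, and a functional that is maximal there and
increases along the ray. -/
theorem exists_last_point_and_functional [NormedSpace ℝ E] {Q : Set E} (hfin : Q.Finite) {r : E}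
    (hr : r ≠ 0) {ε : ℝ} (hε : 0 < ε) (hεQ : ε • r ∈ convexHull ℝ Q) :
    ∃ t : ℝ, 0 < t ∧ t • r ∈ convexHull ℝ Q ∧
      ∃ l : StrongDual ℝ E, 0 < l r ∧ ∀ q ∈ Q, l q ≤ l (t • r) := by
  classical
  have hcomp := hfin.isCompact_convexHull ℝ
  obtain ⟨R, hR⟩ := hcomp.isBounded.exists_norm_le
  have hr0 : 0 < ‖r‖ := norm_pos_iff.2 hr
  have hTcomp : IsCompact (Set.Icc 0 (R / ‖r‖) ∩ (fun t : ℝ => t • r) ⁻¹' convexHull ℝ Q) :=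
    isCompact_Icc.inter_right (hcomp.isClosed.preimage (by fun_prop))
  have hmemT : ∀ t : ℝ, 0 ≤ t → t • r ∈ convexHull ℝ Q →
      t ∈ Set.Icc 0 (R / ‖r‖) ∩ (fun t : ℝ => t • r) ⁻¹' convexHull ℝ Q := by
    intro t ht htQ
    refine ⟨⟨ht, ?_⟩, htQ⟩
    rw [le_div_iff₀ hr0]
    simpa [norm_smul, abs_of_nonneg ht] using hR _ htQ
  obtain ⟨t, htmem, htmax⟩ := hTcomp.exists_isGreatest ⟨ε, hmemT ε hε.le hεQ⟩
  have ht : 0 < t := hε.trans_le (htmax (hmemT ε hε.le hεQ))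
  refine ⟨t, ht, htmem.2, ?_⟩
  -- Without such a functional, Farkas puts `r` in the cone generated by the `q - t • r`.
  -- Normalizing the coefficients, with sum `s`, then yields the later point `(t + s⁻¹) • r` of the
  -- hull.
  by_contra! hcon
  obtain ⟨c, hc, hcp⟩ := farkas_finset hfin.toFinset (fun q => q - t • r) r (by
    intro l hl
    by_contra! hlr
    obtain ⟨q, hq, hlt⟩ := hcon l hlr
    have := hl q (hfin.mem_toFinset.2 hq)
    rw [map_sub] at this
    linarith)
  set s := ∑ q ∈ hfin.toFinset, c q with hs
  have hs0 : 0 ≤ s := Finset.sum_nonneg hc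
  have hsum : ∑ q ∈ hfin.toFinset, c q • q = (1 + s * t) • r := by
    simp only [smul_sub, Finset.sum_sub_distrib] at hcp
    rw [← Finset.sum_smul, sub_eq_iff_eq_add] at hcp
    rw [hcp, add_smul, one_smul, smul_smul]
  have hspos : 0 < s := by
    refine lt_of_le_of_ne hs0 fun h0 => hr ?_
    have hz := (Finset.sum_eq_zero_iff_of_nonneg hc).1 h0.symm
    rw [← hcp]
    exact Finset.sum_eq_zero fun q hq => by rw [hz q hq, zero_smul]
  have hmem : (t + s⁻¹) • r ∈ convexHull ℝ Q := by
    have e : (t + s⁻¹) • r = hfin.toFinset.centerMass c id := by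
      simp only [Finset.centerMass, id]
      rw [← hs, hsum, smul_smul]
      congr 1
      field_simp
      ring
    rw [e]
    exact Finset.centerMass_mem_convexHull _ hc hspos fun q hq => hfin.mem_toFinset.1 hq
  have := htmax (hmemT _ (by positivity) hmem)
  have : 0 < s⁻¹ := by positivity
  linarith

end Polytopes

/-! ### Proper faces and the ray bound for the facial distance. -/

section ProperFaces

variable {d : ℕ} {A : Set (EuclideanSpace ℝ (Fin d))}

theorem setDist_le {s t : Set (EuclideanSpace ℝ (Fin d))} {x y : EuclideanSpace ℝ (Fin d)}
    (hx : x ∈ s) (hy : y ∈ t) : setDist s t ≤ dist x y :=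
  csInf_le ⟨0, by rintro _ ⟨x, -, y, -, rfl⟩; exact dist_nonneg⟩ ⟨x, hx, y, hy, rfl⟩

theorem setDist_nonneg (s t : Set (EuclideanSpace ℝ (Fin d))) : 0 ≤ setDist s t :=
  Real.sInf_nonneg (by rintro _ ⟨x, -, y, -, rfl⟩; exact dist_nonneg)

theorem le_setDist {s t : Set (EuclideanSpace ℝ (Fin d))} (hs : s.Nonempty) (ht : t.Nonempty)
    {δ : ℝ} (h : ∀ x ∈ s, ∀ y ∈ t, δ ≤ dist x y) : δ ≤ setDist s t := by
  obtain ⟨x, hx⟩ := hs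
  obtain ⟨y, hy⟩ := ht
  refine le_csInf ⟨_, x, hx, y, hy, rfl⟩ ?_
  rintro _ ⟨x, hx, y, hy, rfl⟩
  exact h x hx y hy

theorem exists_setDist_eq_dist {s t : Set (EuclideanSpace ℝ (Fin d))} (hs : IsCompact s)
    (ht : IsCompact t) (hs0 : s.Nonempty) (ht0 : t.Nonempty) :
    ∃ u ∈ s, ∃ z ∈ t, setDist s t = dist u z := by
  obtain ⟨⟨u, z⟩, hm, hmin⟩ := (hs.prod ht).exists_isMinOn (hs0.prod ht0)
    continuous_dist.continuousOn
  refine ⟨u, hm.1, z, hm.2, le_antisymm (setDist_le hm.1 hm.2) (le_setDist hs0 ht0 ?_)⟩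
  exact fun x hx y hy => isMinOn_iff.1 hmin (x, y) ⟨hx, hy⟩

/-- A nearest point `z` of a convex set to `u` separates it from `u`. -/
theorem inner_sub_le_of_forall_dist_le {t : Set (EuclideanSpace ℝ (Fin d))} (ht : Convex ℝ t)
    {u z : EuclideanSpace ℝ (Fin d)} (hz : z ∈ t) (h : ∀ y ∈ t, dist u z ≤ dist u y)
    {y : EuclideanSpace ℝ (Fin d)} (hy : y ∈ t) : inner ℝ (u - z) y ≤ inner ℝ (u - z) z := by
  have : Nonempty t := ⟨⟨z, hz⟩⟩
  have key : ‖u - z‖ = ⨅ w : t, ‖u - w‖ := by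
    refine le_antisymm (le_ciInf fun w => ?_) (ciInf_le ⟨0, ?_⟩ (⟨z, hz⟩ : t))
    · simpa [dist_eq_norm] using h w w.2
    · rintro _ ⟨w, rfl⟩
      exact norm_nonneg _
  have := (norm_eq_iInf_iff_real_inner_le_zero ht hz).1 key y hy
  rw [inner_sub_right] at this
  linarith

/-- Maximizers of a nonconstant functional form a proper face. -/
theorem isProperFace_toExposed {C : Set (EuclideanSpace ℝ (Fin d))}
    (l : StrongDual ℝ (EuclideanSpace ℝ (Fin d))) {u z : EuclideanSpace ℝ (Fin d)}
    (hu : u ∈ C) (hmax : ∀ y ∈ C, l y ≤ l u) (hz : z ∈ C) (hzu : l z < l u) :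
    IsProperFace C (l.toExposed C) := by
  refine ⟨ContinuousLinearMap.toExposed.isExposed, ⟨u, hu, hmax⟩, fun h => ?_⟩
  rw [← h] at hz
  exact (hz.2 u hu).not_gt hzu

theorem IsProperFace.nonempty_diff {F : Set (EuclideanSpace ℝ (Fin d))}
    (hF : IsProperFace (convexHull ℝ A) F) : (A \ F).Nonempty := by
  by_contra! h
  exact hF.2.2 (hF.1.subset.antisymm
    (convexHull_min (Set.sdiff_eq_empty.1 h) (hF.1.convex (convex_convexHull ℝ A))))

theorem IsProperFace.isCompact (hfin : A.Finite) {F : Set (EuclideanSpace ℝ (Fin d))}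
    (hF : IsProperFace (convexHull ℝ A) F) : IsCompact F :=
  hF.1.isCompact (hfin.isCompact_convexHull ℝ)

/-- Guards against the convention `sInf ∅ = 0` in the facial distances. The functional `⟨b - a, ·⟩`
separates two distinct atoms, so its maximizers are not the whole hull. -/
theorem exists_isProperFace (hfin : A.Finite) (hA : A.Nontrivial) :
    ∃ F, IsProperFace (convexHull ℝ A) F := by
  obtain ⟨a, ha, b, hb, hab⟩ := hA
  set l := innerSL ℝ (b - a)
  obtain ⟨u, hu, hmax⟩ := (hfin.isCompact_convexHull ℝ).exists_isMaxOn
    ⟨a, subset_convexHull ℝ A ha⟩ l.continuous.continuousOn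
  refine ⟨_, isProperFace_toExposed l hu hmax (subset_convexHull ℝ A ha) ?_⟩
  refine lt_of_lt_of_le ?_ (hmax (subset_convexHull ℝ A hb))
  have : 0 < l (b - a) := by
    rw [innerSL_apply_apply, real_inner_self_eq_norm_sq]
    have := norm_pos_iff.2 (sub_ne_zero.2 hab.symm)
    positivity
  rw [map_sub] at this
  linarith

/-- A functional supporting `conv (K ∩ A) - conv S` at the exit point of the ray splits into a
maximum over `K` at `u` and a minimum over `conv S` at `z`. The face is the set of maximizers in
`K`. -/
theorem IsExposed.exists_properFace_of_ray (hfin : A.Finite)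
    {K S : Set (EuclideanSpace ℝ (Fin d))}
    (hK : IsExposed ℝ (convexHull ℝ A) K) (hSK : S ⊆ K ∩ A) {x r : EuclideanSpace ℝ (Fin d)}
    (hx : x ∈ convexHull ℝ S) (hr : r ≠ 0) {ε : ℝ} (hε : 0 < ε) (hxr : x + ε • r ∈ K) :
    ∃ F, IsProperFace (convexHull ℝ A) F ∧ ∃ u ∈ F, ∃ z ∈ convexHull ℝ (A \ F),
      u ∈ convexHull ℝ (K ∩ A) ∧ z ∈ convexHull ℝ S ∧ ∃ t : ℝ, 0 < t ∧ u - z = t • r := by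
  have hSfin : S.Finite := hfin.subset fun s hs => (hSK hs).2
  have hconv : ∀ u z, u ∈ convexHull ℝ (K ∩ A) → z ∈ convexHull ℝ S →
      u - z ∈ convexHull ℝ (Set.image2 (fun a b => a - b) (K ∩ A) S) := fun u z hu hz => by
    open scoped Pointwise in
    exact (convexHull_sub (R := ℝ) (K ∩ A) S).ge (Set.sub_mem_sub hu hz)
  have hεQ : ε • r ∈ convexHull ℝ (Set.image2 (fun a b => a - b) (K ∩ A) S) := by
    have := hconv (x + ε • r) x (hK.eq_convexHull_inter ▸ hxr) hx
    rwa [add_sub_cancel_left] at this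
  obtain ⟨t, ht, htQ, l, hlr, hl⟩ := exists_last_point_and_functional
    (Set.Finite.image2 _ (hfin.subset Set.inter_subset_right) hSfin) hr hε hεQ
  obtain ⟨u, hu, z, hz, huz⟩ : ∃ u ∈ convexHull ℝ (K ∩ A), ∃ z ∈ convexHull ℝ S, u - z = t • r := by
    open scoped Pointwise in
    exact (convexHull_sub (R := ℝ) (K ∩ A) S).le htQ
  rw [← huz] at hl
  have hmax : ∀ y ∈ K, l y ≤ l u := by
    intro y hy
    rw [hK.eq_convexHull_inter] at hy
    have := sub_le_of_mem_convexHull (fun a ha b hb => hl _ ⟨a, ha, b, hb, rfl⟩) hy hz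
    simpa using this
  have hmin : ∀ s ∈ S, (-l) s ≤ -l z := by
    intro s hs
    have := sub_le_of_mem_convexHull (fun a ha b hb => hl _ ⟨a, ha, b, hb, rfl⟩) hu
      (subset_convexHull ℝ S hs)
    rw [map_sub, map_sub] at this
    rw [neg_apply]
    linarith
  have hlt : l z < l u := by
    have : l (u - z) = t * l r := by rw [huz]; simp
    rw [map_sub] at this
    have := mul_pos ht hlr
    linarith
  have huK : u ∈ K := by rw [hK.eq_convexHull_inter]; exact hu
  have hSC : convexHull ℝ S ⊆ K := convexHull_min (fun s hs => (hSK hs).1)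
    (hK.convex (convex_convexHull ℝ A))
  have hF := isProperFace_toExposed l huK hmax (hSC hz) hlt
  refine ⟨l.toExposed K, ⟨hK.trans_convexHull hfin hF.1, hF.2.1, fun h => ?_⟩, u, ⟨huK, hmax⟩,
    z, ?_, hu, hz, t, ht, huz⟩
  · exact hF.2.2 (hF.1.subset.antisymm (h ▸ hK.subset))
  -- Only atoms of `S` with `l`-value `l z` contribute to `z`, and `l z < l u` keeps them off the
  -- face.
  · refine convexHull_mono ?_ (mem_convexHull_maximizers hmin hz (by simp))
    rintro s ⟨hs, hsz⟩
    refine ⟨(hSK hs).2, fun hsF => ?_⟩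
    have := hsF.2 u huK
    simp only [neg_apply] at hsz
    linarith

theorem bddBelow_facial (P : Set (EuclideanSpace ℝ (Fin d)) → Prop)
    (f g : Set (EuclideanSpace ℝ (Fin d)) → Set (EuclideanSpace ℝ (Fin d))) :
    BddBelow {t : ℝ | ∃ F, P F ∧ t = setDist (f F) (g F)} :=
  ⟨0, by rintro _ ⟨F, -, rfl⟩; exact setDist_nonneg _ _⟩

theorem atomicFacialDist_le {F : Set (EuclideanSpace ℝ (Fin d))}
    (hF : IsProperFace (convexHull ℝ A) F) {u z : EuclideanSpace ℝ (Fin d)} (hu : u ∈ F)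
    (hz : z ∈ convexHull ℝ (A \ F)) : atomicFacialDist A ≤ dist u z :=
  (csInf_le (bddBelow_facial _ _ _) ⟨F, hF, rfl⟩).trans (setDist_le hu hz)

/-- The facial distance is a lower bound for the extent of a face along a ray contained in it. -/
theorem atomicFacialDist_le_of_ray (hfin : A.Finite) {K S : Set (EuclideanSpace ℝ (Fin d))}
    (hK : IsExposed ℝ (convexHull ℝ A) K) (hSK : S ⊆ K ∩ A) {x r : EuclideanSpace ℝ (Fin d)}
    (hx : x ∈ convexHull ℝ S) (hr : r ≠ 0) {ε : ℝ} (hε : 0 < ε) (hxr : x + ε • r ∈ K) {σ : ℝ}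
    (hσ : ∀ s ∈ K ∩ A, ∀ v ∈ S, inner ℝ (‖r‖⁻¹ • r) (s - v) ≤ σ) : atomicFacialDist A ≤ σ := by
  obtain ⟨F, hF, u, huF, z, hzF, hu, hz, t, ht, huz⟩ :=
    hK.exists_properFace_of_ray hfin hSK hx hr hε hxr
  refine (atomicFacialDist_le hF huF hzF).trans ?_
  -- As `u - z` is a positive multiple of `r`, its length is its component along `r`, and the bound
  -- on atoms passes to convex hulls.
  have := sub_le_of_mem_convexHull (l := innerSL ℝ (‖r‖⁻¹ • r))
    (fun a ha b hb => by simpa only [innerSL_apply_apply] using hσ a ha b hb) hu hz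
  refine le_trans (le_of_eq ?_) this
  have hr0 := norm_ne_zero_iff.2 hr
  rw [innerSL_apply_apply, dist_eq_norm, huz, norm_smul, Real.norm_of_nonneg ht.le,
    inner_smul_left, inner_smul_right, real_inner_self_eq_norm_sq]
  simp only [conj_trivial]
  field_simp

end ProperFaces

/-! ### Comparison of the facial distance with the widths. -/

section Widths

variable {d : ℕ} {A : Set (EuclideanSpace ℝ (Fin d))}

theorem dirWidth_nonneg (S : Set (EuclideanSpace ℝ (Fin d))) (r : EuclideanSpace ℝ (Fin d)) :
    0 ≤ dirWidth S r := by
  rcases S.eq_empty_or_nonempty with rfl | ⟨s, hs⟩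
  · simp [dirWidth]
  · exact Real.sSup_nonneg' ⟨0, ⟨s, hs, s, hs, by simp⟩, le_rfl⟩

theorem setWidth_nonneg (S : Set (EuclideanSpace ℝ (Fin d))) : 0 ≤ setWidth S :=
  Real.sInf_nonneg (by rintro _ ⟨r, -, -, rfl⟩; exact dirWidth_nonneg S r)

theorem setWidth_le_dirWidth {S : Set (EuclideanSpace ℝ (Fin d))} {r : EuclideanSpace ℝ (Fin d)}
    (hr : r ∈ (affineSpan ℝ S).direction) (hr0 : r ≠ 0) : setWidth S ≤ dirWidth S r :=
  csInf_le ⟨0, by rintro _ ⟨r, -, -, rfl⟩; exact dirWidth_nonneg S r⟩ ⟨r, hr, hr0, rfl⟩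

theorem minwidth_le_setWidth {S : Set (EuclideanSpace ℝ (Fin d))} (hSA : S ⊆ A)
    (hS : S.Nontrivial) : minwidth A ≤ setWidth S :=
  csInf_le ⟨0, by rintro _ ⟨S, -, -, rfl⟩; exact setWidth_nonneg S⟩ ⟨S, hSA, hS, rfl⟩

theorem IsProperConvexCombination.nonempty {T : Finset (EuclideanSpace ℝ (Fin d))}
    {x : EuclideanSpace ℝ (Fin d)} (h : IsProperConvexCombination T x) : T.Nonempty := by
  obtain ⟨w, -, hw, -⟩ := h
  by_contra hT
  rw [Finset.not_nonempty_iff_eq_empty] at hT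
  simp [hT] at hw

theorem IsProperConvexCombination.mem_convexHull {T : Finset (EuclideanSpace ℝ (Fin d))}
    {x : EuclideanSpace ℝ (Fin d)} (h : IsProperConvexCombination T x) :
    x ∈ convexHull ℝ (T : Set (EuclideanSpace ℝ (Fin d))) := by
  obtain ⟨w, hw0, hw1, rfl⟩ := h
  exact (convex_convexHull ℝ _).sum_mem (fun v hv => (hw0 v hv).le) hw1
    fun v hv => subset_convexHull ℝ _ hv

theorem exists_isProperConvexCombination {B : Set (EuclideanSpace ℝ (Fin d))}
    {x : EuclideanSpace ℝ (Fin d)} (hx : x ∈ convexHull ℝ B) :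
    ∃ T : Finset (EuclideanSpace ℝ (Fin d)), (T : Set (EuclideanSpace ℝ (Fin d))) ⊆ B ∧
      IsProperConvexCombination T x := by
  classical
  rw [convexHull_eq_union_convexHull_finite_subsets] at hx
  simp only [Set.mem_iUnion] at hx
  obtain ⟨T, hTB, hx⟩ := hx
  rw [Finset.mem_convexHull'] at hx
  obtain ⟨w, hw0, hw1, hwx⟩ := hx
  refine ⟨T.filter (fun v => w v ≠ 0), fun v hv => hTB (Finset.mem_filter.1 hv).1, w,
    fun v hv => ?_, ?_, ?_⟩
  · obtain ⟨hv, hv0⟩ := Finset.mem_filter.1 hv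
    exact lt_of_le_of_ne (hw0 v hv) (Ne.symm hv0)
  · rw [Finset.sum_filter_ne_zero, hw1]
  · rw [← hwx, Finset.sum_filter]
    refine Finset.sum_congr rfl fun v _ => ?_
    split_ifs with h
    · rfl
    · rw [not_not.1 h, zero_smul]

theorem sSup_pyr_nonneg {B : Set (EuclideanSpace ℝ (Fin d))}
    {T : Finset (EuclideanSpace ℝ (Fin d))} (hTB : (T : Set (EuclideanSpace ℝ (Fin d))) ⊆ B)
    {x : EuclideanSpace ℝ (Fin d)} (hT : IsProperConvexCombination T x)
    (r : EuclideanSpace ℝ (Fin d)) :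
    0 ≤ sSup {u : ℝ | ∃ s ∈ B, ∃ v ∈ T, u = inner ℝ (‖r‖⁻¹ • r) (s - v)} := by
  obtain ⟨v, hv⟩ := hT.nonempty
  exact Real.sSup_nonneg' ⟨0, ⟨v, hTB hv, v, hv, by simp⟩, le_rfl⟩

theorem pyrDirWidth_nonneg (B : Set (EuclideanSpace ℝ (Fin d)))
    (r x : EuclideanSpace ℝ (Fin d)) : 0 ≤ pyrDirWidth B r x :=
  Real.sInf_nonneg (by rintro _ ⟨T, hTB, hT, rfl⟩; exact sSup_pyr_nonneg hTB hT r)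

theorem pyrDirWidth_le {B : Set (EuclideanSpace ℝ (Fin d))} (hB : B.Nonempty)
    {T : Finset (EuclideanSpace ℝ (Fin d))} (hTB : (T : Set (EuclideanSpace ℝ (Fin d))) ⊆ B)
    {r x : EuclideanSpace ℝ (Fin d)} (hT : IsProperConvexCombination T x) {σ : ℝ}
    (h : ∀ s ∈ B, ∀ v ∈ T, inner ℝ (‖r‖⁻¹ • r) (s - v) ≤ σ) : pyrDirWidth B r x ≤ σ := by
  have hle : pyrDirWidth B r x ≤
      sSup {u : ℝ | ∃ s ∈ B, ∃ v ∈ T, u = inner ℝ (‖r‖⁻¹ • r) (s - v)} :=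
    csInf_le ⟨0, by rintro _ ⟨T, hTB, hT, rfl⟩; exact sSup_pyr_nonneg hTB hT r⟩
      ⟨T, hTB, hT, rfl⟩
  refine hle.trans (csSup_le ?_ ?_)
  · obtain ⟨s, hs⟩ := hB
    obtain ⟨v, hv⟩ := hT.nonempty
    exact ⟨_, s, hs, v, hv, rfl⟩
  · rintro _ ⟨s, hs, v, hv, rfl⟩
    exact h s hs v hv

theorem pyrWidth_le {K : Set (EuclideanSpace ℝ (Fin d))} {x r : EuclideanSpace ℝ (Fin d)}
    (hK : IsExposed ℝ (convexHull ℝ A) K) (hx : x ∈ K)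
    (hr : r ∈ PointedCone.hull ℝ ((fun y => y - x) '' K)) (hr0 : r ≠ 0) :
    pyrWidth A ≤ pyrDirWidth (K ∩ A) r x :=
  csInf_le ⟨0, by rintro _ ⟨K, x, r, -, -, -, -, rfl⟩; exact pyrDirWidth_nonneg _ r x⟩
    ⟨K, x, r, hK, hx, hr, hr0, rfl⟩

theorem exists_add_smul_mem_of_mem_hull {K : Set (EuclideanSpace ℝ (Fin d))} (hK : Convex ℝ K)
    {x r : EuclideanSpace ℝ (Fin d)} (hx : x ∈ K)
    (hr : r ∈ PointedCone.hull ℝ ((fun y => y - x) '' K)) :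
    ∃ ε : ℝ, 0 < ε ∧ x + ε • r ∈ K := by
  induction hr using Submodule.span_induction with
  | mem r hr =>
    obtain ⟨y, hy, rfl⟩ := hr
    exact ⟨1, one_pos, by simpa using hy⟩
  | zero => exact ⟨1, one_pos, by simpa using hx⟩
  | add r₁ r₂ _ _ h₁ h₂ =>
    obtain ⟨ε₁, hε₁, h₁⟩ := h₁
    obtain ⟨ε₂, hε₂, h₂⟩ := h₂
    -- The convex weights proportional to `ε₂` and `ε₁` give `r₁` and `r₂` this same coefficient.
    refine ⟨ε₁ * ε₂ / (ε₁ + ε₂), by positivity, ?_⟩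
    have := hK h₁ h₂ (a := ε₂ / (ε₁ + ε₂)) (b := ε₁ / (ε₁ + ε₂)) (by positivity) (by positivity)
      (by field_simp; ring)
    convert this using 1
    have e : x = (ε₂ / (ε₁ + ε₂)) • x + (ε₁ / (ε₁ + ε₂)) • x := by
      rw [← add_smul, ← add_div, add_comm ε₂, div_self (by positivity), one_smul]
    conv_lhs => rw [e]
    module
  | smul c r _ h =>
    obtain ⟨ε, hε, h⟩ := h
    rcases eq_or_ne c 0 with rfl | hc
    · exact ⟨1, one_pos, by simpa using hx⟩
    have hc0 : (0 : ℝ) < c := lt_of_le_of_ne c.2 fun h => hc (Subtype.ext h.symm)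
    refine ⟨ε / c, by positivity, ?_⟩
    convert h using 2
    change (ε / (c : ℝ)) • (c : ℝ) • r = ε • r
    rw [smul_smul, div_mul_cancel₀ _ hc0.ne']

theorem atomicFacialDist_le_pyrWidth (hfin : A.Finite) (hA : A.Nontrivial) :
    atomicFacialDist A ≤ pyrWidth A := by
  refine le_csInf ?_ ?_
  · obtain ⟨a, ha, b, hb, hab⟩ := hA
    exact ⟨_, convexHull ℝ A, a, b - a, IsExposed.refl _, subset_convexHull ℝ A ha,
      PointedCone.subset_hull ⟨b, subset_convexHull ℝ A hb, rfl⟩, sub_ne_zero.2 hab.symm, rfl⟩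
  · rintro _ ⟨K, x, r, hK, hx, hr, hr0, rfl⟩
    refine le_csInf ?_ ?_
    · obtain ⟨T, hT, hTx⟩ := exists_isProperConvexCombination (hK.eq_convexHull_inter ▸ hx)
      exact ⟨_, T, hT, hTx, rfl⟩
    · rintro _ ⟨T, hT, hTx, rfl⟩
      obtain ⟨ε, hε, hεK⟩ := exists_add_smul_mem_of_mem_hull
        (hK.convex (convex_convexHull ℝ A)) hx hr
      refine atomicFacialDist_le_of_ray hfin hK hT hTx.mem_convexHull hr0 hε hεK ?_
      intro s hs v hv
      refine le_csSup (Set.Finite.bddAbove ?_) ⟨s, hs, v, hv, rfl⟩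
      refine ((hfin.subset Set.inter_subset_right : (K ∩ A).Finite).image2
        (fun s v => inner ℝ (‖r‖⁻¹ • r) (s - v)) T.finite_toSet).subset ?_
      rintro _ ⟨s, hs, v, hv, rfl⟩
      exact ⟨s, hs, v, hv, rfl⟩

theorem inner_inv_norm_smul_le_norm {r y : EuclideanSpace ℝ (Fin d)} (hr : r ≠ 0)
    (h : inner ℝ r y ≤ inner ℝ r r) : inner ℝ (‖r‖⁻¹ • r) y ≤ ‖r‖ := by
  have hr0 := norm_pos_iff.2 hr
  rw [real_inner_self_eq_norm_sq] at h
  rw [real_inner_smul_left, inv_mul_le_iff₀ hr0]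
  linarith

/-- Compactness gives the nearest pair, and the projection inequality at each end gives the two
walls of an empty slab between `F` and the remaining atoms. -/
theorem IsProperFace.exists_nearest (hfin : A.Finite) {F : Set (EuclideanSpace ℝ (Fin d))}
    (hF : IsProperFace (convexHull ℝ A) F) :
    ∃ u ∈ F, ∃ z ∈ convexHull ℝ (A \ F), setDist F (convexHull ℝ (A \ F)) = dist u z ∧ u ≠ z ∧
      (∀ y ∈ F, inner ℝ (u - z) u ≤ inner ℝ (u - z) y) ∧
      ∀ y ∈ convexHull ℝ (A \ F), inner ℝ (u - z) y ≤ inner ℝ (u - z) z := by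
  have hconv : Convex ℝ F := hF.1.convex (convex_convexHull ℝ A)
  have hfin' : (A \ F).Finite := hfin.subset Set.sdiff_subset
  obtain ⟨u, hu, z, hz, huz⟩ := exists_setDist_eq_dist (hF.isCompact hfin)
    (hfin'.isCompact_convexHull ℝ) hF.2.1 hF.nonempty_diff.convexHull
  refine ⟨u, hu, z, hz, huz, ?_, fun y hy => ?_, fun y hy => ?_⟩
  -- A common point would maximize the functional exposing `F`, and then so would some atom outside
  -- `F`.
  · rintro rfl
    obtain ⟨l, hl⟩ := hF.1 hF.2.1
    have hu' := hu
    rw [hl] at hu'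
    have := mem_convexHull_maximizers (A := A \ F) (l := l) (α := l u)
      (fun a ha => hu'.2 a (subset_convexHull ℝ A ha.1)) hz le_rfl
    have hne := convexHull_nonempty_iff.1 ⟨u, this⟩
    obtain ⟨a, ⟨ha, haF⟩, hau⟩ := hne
    refine haF ?_
    rw [hl]
    exact ⟨subset_convexHull ℝ A ha, fun y hy => hau ▸ hu'.2 y hy⟩
  · have := inner_sub_le_of_forall_dist_le hconv (u := z) hu
      (fun y hy => by rw [dist_comm, ← huz, dist_comm]; exact setDist_le hy hz) hy
    rw [← neg_sub, inner_neg_left, inner_neg_left] at this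
    linarith
  · exact inner_sub_le_of_forall_dist_le (convex_convexHull ℝ _) hz
      (fun y hy => huz ▸ setDist_le hu hy) hy

/-- The atoms on the two walls of the slab suffice: their hulls contain `u` and `z`, so `u - z` is
an admissible direction, and the width in that direction is the thickness of the slab. -/
theorem minwidth_le_atomicFacialDist (hfin : A.Finite) (hA : A.Nontrivial) :
    minwidth A ≤ atomicFacialDist A := by
  obtain ⟨F₀, hF₀⟩ := exists_isProperFace hfin hA
  refine le_csInf ⟨_, F₀, hF₀, rfl⟩ ?_
  rintro _ ⟨F, hF, rfl⟩
  obtain ⟨u, hu, z, hz, huz, hne, hFu, hFz⟩ := hF.exists_nearest hfin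
  set r := u - z with hr
  have hr0 : r ≠ 0 := sub_ne_zero.2 hne
  set S₁ := {a ∈ F ∩ A | (-innerSL ℝ r) a = (-innerSL ℝ r) u}
  set S₂ := {a ∈ A \ F | innerSL ℝ r a = innerSL ℝ r z}
  have hu₁ : u ∈ convexHull ℝ S₁ := by
    refine mem_convexHull_maximizers (fun a ha => ?_) (hF.1.eq_convexHull_inter ▸ hu) le_rfl
    simpa using hFu a ha.1
  have hz₂ : z ∈ convexHull ℝ S₂ := by
    refine mem_convexHull_maximizers (fun a ha => ?_) hz le_rfl
    simpa using hFz a (subset_convexHull ℝ _ ha)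
  have h₁ : ∀ a ∈ S₁, inner ℝ r a = inner ℝ r u := fun a ha => by simpa using ha.2
  have h₂ : ∀ a ∈ S₂, inner ℝ r a = inner ℝ r z := fun a ha => by simpa using ha.2
  have hrr : inner ℝ r r = inner ℝ r u - inner ℝ r z := by rw [← inner_sub_right]
  have hrr0 : 0 < inner ℝ r r := real_inner_self_pos.2 hr0
  obtain ⟨a₁, ha₁⟩ := convexHull_nonempty_iff.1 ⟨u, hu₁⟩
  obtain ⟨a₂, ha₂⟩ := convexHull_nonempty_iff.1 ⟨z, hz₂⟩
  have hS : (S₁ ∪ S₂).Nontrivial := ⟨a₁, Or.inl ha₁, a₂, Or.inr ha₂, by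
    rintro rfl
    exact ha₂.1.2 ha₁.1.1⟩
  have hSA : S₁ ∪ S₂ ⊆ A := Set.union_subset (fun a ha => ha.1.2) (fun a ha => ha.1.1)
  have hdir : r ∈ (affineSpan ℝ (S₁ ∪ S₂)).direction := by
    have hsub := convexHull_subset_affineSpan (𝕜 := ℝ) (S₁ ∪ S₂)
    exact AffineSubspace.vsub_mem_direction (hsub (convexHull_mono Set.subset_union_left hu₁))
      (hsub (convexHull_mono Set.subset_union_right hz₂))
  refine (minwidth_le_setWidth hSA hS).trans ((setWidth_le_dirWidth hdir hr0).trans ?_)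
  rw [huz, dist_eq_norm]
  refine csSup_le ⟨_, a₁, Or.inl ha₁, a₁, Or.inl ha₁, rfl⟩ ?_
  rintro _ ⟨s, hs, v, hv, rfl⟩
  refine inner_inv_norm_smul_le_norm hr0 ?_
  rw [inner_sub_right]
  rcases hs with hs | hs <;> rcases hv with hv | hv
  · rw [h₁ s hs, h₁ v hv]; linarith
  · rw [h₁ s hs, h₂ v hv]; linarith
  · rw [h₂ s hs, h₁ v hv]; linarith
  · rw [h₂ s hs, h₂ v hv]; linarith

/-- Induction on the number of atoms in `F`. If all of them lie on the wall through `u`, no atom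
passes that wall, and base point `z` with direction `u - z` gives the bound. -/
theorem IsProperFace.pyrWidth_le_setDist (hfin : A.Finite) {F : Set (EuclideanSpace ℝ (Fin d))}
    (hF : IsProperFace (convexHull ℝ A) F) : pyrWidth A ≤ setDist F (convexHull ℝ (A \ F)) := by
  induction hn : (F ∩ A).ncard using Nat.strong_induction_on generalizing F with
  | _ n ih =>
  obtain ⟨u, hu, z, hz, huz, hne, hFu, hFz⟩ := hF.exists_nearest hfin
  set r := u - z with hr
  have hr0 : r ≠ 0 := sub_ne_zero.2 hne
  have hrr : inner ℝ r r = inner ℝ r u - inner ℝ r z := by rw [← inner_sub_right]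
  have hrr0 : 0 < inner ℝ r r := real_inner_self_pos.2 hr0
  set G := (-innerSL ℝ r).toExposed F
  have huG : u ∈ G := ⟨hu, fun y hy => by simpa using hFu y hy⟩
  have hGF : G ⊆ F := fun y hy => hy.1
  have hG : IsProperFace (convexHull ℝ A) G :=
    ⟨hF.1.trans_convexHull hfin ContinuousLinearMap.toExposed.isExposed, ⟨u, huG⟩,
      fun h => hF.2.2 (hF.1.subset.antisymm (h ▸ hGF))⟩
  rcases (Set.inter_subset_inter_left A hGF).eq_or_ssubset with heq | hss
  · obtain ⟨T, hTsub, hT⟩ := exists_isProperConvexCombination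
      (mem_convexHull_maximizers (A := A \ F) (l := innerSL ℝ r) (α := innerSL ℝ r z)
        (fun a ha => by simpa using hFz a (subset_convexHull ℝ _ ha)) hz le_rfl)
    have hzC : z ∈ convexHull ℝ A := convexHull_mono Set.sdiff_subset hz
    have huC : u ∈ convexHull ℝ A := hF.1.subset hu
    refine (pyrWidth_le (K := convexHull ℝ A) (x := z) (r := r) (IsExposed.refl _) hzC
      (PointedCone.subset_hull ⟨u, huC, rfl⟩) hr0).trans ?_
    rw [Set.inter_eq_right.2 (subset_convexHull ℝ A), huz, dist_eq_norm]
    refine pyrDirWidth_le hF.nonempty_diff.of_sdiff (fun v hv => (hTsub hv).1.1) hT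
      fun s hs v hv => inner_inv_norm_smul_le_norm hr0 ?_
    have hvz : inner ℝ r v = inner ℝ r z := by simpa using (hTsub hv).2
    rw [inner_sub_right, hvz]
    by_cases hsF : s ∈ F
    · have hsG : s ∈ G := (heq.ge ⟨hsF, hs⟩).1
      have : inner ℝ r s ≤ inner ℝ r u := by simpa using hsG.2 u hu
      linarith
    · have := hFz s (subset_convexHull ℝ _ ⟨hs, hsF⟩)
      linarith
  -- Otherwise `G`, the part of `F` on the wall, has fewer atoms; it still contains `u`, and `z`
  -- still lies in the hull of the atoms off it, so its distance is no larger.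
  · refine (ih _ (hn ▸ Set.ncard_lt_ncard hss (hfin.subset Set.inter_subset_right)) hG rfl).trans ?_
    rw [huz]
    exact setDist_le huG (convexHull_mono (Set.sdiff_subset_sdiff_right hGF) hz)

theorem pyrWidth_le_atomicFacialDist (hfin : A.Finite) (hA : A.Nontrivial) :
    pyrWidth A ≤ atomicFacialDist A := by
  obtain ⟨F₀, hF₀⟩ := exists_isProperFace hfin hA
  refine le_csInf ⟨_, F₀, hF₀, rfl⟩ ?_
  rintro _ ⟨F, hF, rfl⟩
  exact hF.pyrWidth_le_setDist hfin

theorem facialDist_convexHull_eq_atomicFacialDist_extremePoints (hfin : A.Finite) :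
    facialDist (convexHull ℝ A) = atomicFacialDist ((convexHull ℝ A).extremePoints ℝ) := by
  rw [facialDist, atomicFacialDist, convexHull_extremePoints_convexHull hfin]

theorem atomicFacialDist_le_facialDist (hfin : A.Finite) (hA : A.Nontrivial) :
    atomicFacialDist A ≤ facialDist (convexHull ℝ A) := by
  obtain ⟨F₀, hF₀⟩ := exists_isProperFace hfin hA
  refine le_csInf ⟨_, F₀, hF₀, rfl⟩ ?_
  rintro _ ⟨F, hF, rfl⟩
  have hne : ((convexHull ℝ A).extremePoints ℝ \ F).Nonempty := by
    refine IsProperFace.nonempty_diff ?_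
    rwa [convexHull_extremePoints_convexHull hfin]
  refine le_setDist hF.2.1 hne.convexHull fun x hx y hy => atomicFacialDist_le hF hx ?_
  exact convexHull_mono (Set.sdiff_subset_sdiff_left extremePoints_convexHull_subset) hy

end Widths

/-! ### Existence of facets and the vertex-facet distance. -/

section Facets

variable {d : ℕ} {A : Set (EuclideanSpace ℝ (Fin d))}

/-- From a relative interior point `y`, a short step towards any point of the affine hull stays in
`F`. -/
theorem exists_lineMap_mem_of_mem_affineSpan {F : Set (EuclideanSpace ℝ (Fin d))}
    (hF : Convex ℝ F) (hF0 : F.Nonempty) {p : EuclideanSpace ℝ (Fin d)}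
    (hp : p ∈ affineSpan ℝ F) :
    ∃ y ∈ F, ∃ ε : ℝ, 0 < ε ∧ ε < 1 ∧ (1 - ε) • y + ε • p ∈ F := by
  obtain ⟨_, ⟨y, hy, rfl⟩⟩ := hF0.intrinsicInterior hF
  have hyF : (y : EuclideanSpace ℝ (Fin d)) ∈ F := interior_subset (s := ((↑) ⁻¹' F : Set (affineSpan ℝ F))) hy
  let f : ℝ → affineSpan ℝ F := fun t =>
    ⟨AffineMap.lineMap (y : EuclideanSpace ℝ (Fin d)) p t, AffineMap.lineMap_mem t y.2 hp⟩
  have hf : Continuous f := by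
    refine Continuous.subtype_mk ?_ _
    exact AffineMap.lineMap_continuous
  have hf0 : f 0 = y := Subtype.ext (by simp [f])
  have hev : ∀ᶠ t in nhds (0 : ℝ), f t ∈ interior ((↑) ⁻¹' F : Set (affineSpan ℝ F)) :=
    hf.continuousAt.eventually_mem (hf0 ▸ isOpen_interior.mem_nhds hy)
  obtain ⟨ε, hε, hmem⟩ := Metric.eventually_nhds_iff.1 hev
  have h2 : 0 < min (ε / 2) (1 / 2) := by positivity
  refine ⟨y, hyF, min (ε / 2) (1 / 2), h2, (min_le_right _ _).trans_lt (by norm_num), ?_⟩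
  have : f (min (ε / 2) (1 / 2)) ∈ interior ((↑) ⁻¹' F : Set (affineSpan ℝ F)) := by
    refine hmem ?_
    rw [Real.dist_eq, sub_zero, abs_of_pos h2]
    exact (min_le_left _ _).trans_lt (by linarith)
  have := interior_subset this
  simpa [f, AffineMap.lineMap_apply_module] using this

theorem direction_affineSpan_le_ker {F : Set (EuclideanSpace ℝ (Fin d))}
    {l : StrongDual ℝ (EuclideanSpace ℝ (Fin d))} {α : ℝ} (h : ∀ x ∈ F, l x = α) :
    ∀ w ∈ (affineSpan ℝ F).direction, l w = 0 := by
  have : (affineSpan ℝ F).direction ≤ LinearMap.ker (l : EuclideanSpace ℝ (Fin d) →ₗ[ℝ] ℝ) := by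
    rw [direction_affineSpan, vectorSpan_def, Submodule.span_le]
    rintro _ ⟨x, hx, y, hy, rfl⟩
    simp [h x hx, h y hy]
  exact fun w hw => this hw

theorem sub_mem_direction_affineSpan {F : Set (EuclideanSpace ℝ (Fin d))}
    {x y : EuclideanSpace ℝ (Fin d)} (hx : x ∈ affineSpan ℝ F) (hy : y ∈ affineSpan ℝ F) :
    x - y ∈ (affineSpan ℝ F).direction :=
  AffineSubspace.vsub_mem_direction hx hy

theorem IsFacet.isProperFace {C F : Set (EuclideanSpace ℝ (Fin d))} (hF : IsFacet C F) :
    IsProperFace C F :=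
  ⟨hF.1, hF.2.1, fun h => by have := hF.2.2; rw [h] at this; omega⟩

theorem finrank_sup_span_singleton_eq {W : Submodule ℝ (EuclideanSpace ℝ (Fin d))}
    {w : EuclideanSpace ℝ (Fin d)} (hw : w ∉ W) :
    Module.finrank ℝ (W ⊔ Submodule.span ℝ {w} : Submodule ℝ (EuclideanSpace ℝ (Fin d))) =
      Module.finrank ℝ W + 1 := by
  refine le_antisymm ?_ ?_
  · refine (Submodule.finrank_add_le_finrank_add_finrank _ _).trans ?_
    have hw0 : w ≠ 0 := fun h => hw (h ▸ W.zero_mem)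
    rw [finrank_span_singleton hw0]
  · refine Nat.succ_le_of_lt (Submodule.finrank_lt_finrank_of_lt ?_)
    refine lt_of_le_of_ne le_sup_left fun h => hw ?_
    rw [h]
    exact Submodule.mem_sup_right (Submodule.mem_span_singleton_self w)

/-- A proper face that is not a facet can be rotated into a larger proper face. -/
theorem IsProperFace.exists_larger (hfin : A.Finite) {F : Set (EuclideanSpace ℝ (Fin d))}
    (hF : IsProperFace (convexHull ℝ A) F) (hnot : ¬ IsFacet (convexHull ℝ A) F) :
    ∃ F', IsProperFace (convexHull ℝ A) F' ∧ A \ F' ⊂ A \ F := by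
  obtain ⟨y₀, hy₀⟩ := hF.2.1
  obtain ⟨l, hl⟩ := hF.1 hF.2.1
  obtain ⟨b, hbA, hbF⟩ := hF.nonempty_diff
  have hsub := subset_convexHull ℝ A
  have hmax : ∀ y ∈ convexHull ℝ A, l y ≤ l y₀ := by rw [hl] at hy₀; exact hy₀.2
  have hFl : ∀ y ∈ F, l y = l y₀ := fun y hy =>
    le_antisymm (hmax y (hF.1.subset hy)) (by rw [hl] at hy; exact hy.2 _ (hF.1.subset hy₀))
  have hlt : ∀ a ∈ A, a ∉ F → l a < l y₀ := fun a ha haF =>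
    lt_of_le_of_ne (hmax a (hsub ha)) fun h => haF (by rw [hl]; exact ⟨hsub ha, h ▸ hmax⟩)
  set U := (affineSpan ℝ (convexHull ℝ A)).direction with hU
  set W := (affineSpan ℝ F).direction with hW
  have hWl : ∀ w ∈ W, l w = 0 := direction_affineSpan_le_ker hFl
  have hspan : ∀ {x}, x ∈ convexHull ℝ A → x ∈ affineSpan ℝ (convexHull ℝ A) :=
    fun hx => subset_affineSpan ℝ _ hx
  have hy₀C := hF.1.subset hy₀
  have hb : l (b - y₀) ≠ 0 := by
    rw [map_sub]
    exact (sub_neg.2 (hlt b hbA hbF)).ne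
  have hWU : W ⊔ Submodule.span ℝ {b - y₀} ≤ U := by
    refine sup_le (AffineSubspace.direction_le (affineSpan_mono ℝ hF.1.subset)) ?_
    rw [Submodule.span_singleton_le_iff_mem]
    exact sub_mem_direction_affineSpan (hspan (hsub hbA)) (hspan hy₀C)
  have hne : W ⊔ Submodule.span ℝ {b - y₀} ≠ U := fun h => by
    refine hnot ⟨hF.1, hF.2.1, ?_⟩
    rw [← finrank_sup_span_singleton_eq (fun h => hb (hWl _ h)), h]
  obtain ⟨e, heU, heW⟩ := SetLike.exists_of_lt (lt_of_le_of_ne hWU hne)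
  set W' := W ⊔ Submodule.span ℝ {b - y₀} with hW'
  -- Tilting `l` by `m` keeps it constant on `F` and unchanged on `b - y₀`, so `b` stays off the new
  -- face and properness survives.
  obtain ⟨m, hmU, hm0, hmW⟩ : ∃ m ∈ U, m ≠ 0 ∧ ∀ w ∈ W', inner ℝ m w = 0 := by
    refine ⟨e - W'.starProjection e, U.sub_mem heU (hWU (W'.starProjection_apply_mem e)), ?_,
      fun w hw => ?_⟩
    · intro h
      rw [sub_eq_zero] at h
      exact heW (h ▸ W'.starProjection_apply_mem e)
    · exact W'.starProjection_inner_eq_zero e w hw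
  obtain ⟨m, hmW, a₁, ha₁, hma₁⟩ : ∃ m : EuclideanSpace ℝ (Fin d),
      (∀ w ∈ W', inner ℝ m w = 0) ∧ ∃ a ∈ A, 0 < inner ℝ m (a - y₀) := by
    obtain ⟨a, ha, hne⟩ : ∃ a ∈ A, inner ℝ m (a - y₀) ≠ 0 := by
      by_contra! hcon
      have hA' : ∀ x ∈ A, innerSL ℝ m x = inner ℝ m y₀ := fun x hx => by
        have := hcon x hx
        rw [inner_sub_right] at this
        simp only [innerSL_apply_apply]
        linarith
      have := direction_affineSpan_le_ker hA' m (by rwa [hU, affineSpan_convexHull] at hmU)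
      exact hm0 (by simpa using this)
    rcases hne.lt_or_gt with h | h
    · exact ⟨-m, fun w hw => by rw [inner_neg_left, hmW w hw, neg_zero], a, ha, by
        rw [inner_neg_left]; linarith⟩
    · exact ⟨m, hmW, a, ha, h⟩
  -- Ratio test: `t` is the first tilt at which an atom off `F` reaches the supporting hyperplane.
  obtain ⟨a₀, ⟨ha₀, hh₀⟩, hmin⟩ := Set.exists_min_image {a ∈ A | 0 < inner ℝ m (a - y₀)}
    (fun a => (l y₀ - l a) / inner ℝ m (a - y₀)) (hfin.subset (Set.sep_subset _ _))
    ⟨a₁, ha₁, hma₁⟩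
  set t := (l y₀ - l a₀) / inner ℝ m (a₀ - y₀) with ht
  have ht0 : 0 ≤ t := div_nonneg (sub_nonneg.2 (hmax a₀ (hsub ha₀))) hh₀.le
  set f : StrongDual ℝ (EuclideanSpace ℝ (Fin d)) := l + t • innerSL ℝ m with hf
  have hfs : ∀ x, f x = f y₀ + (l x - l y₀ + t * inner ℝ m (x - y₀)) := fun x => by
    simp only [hf, add_apply, smul_apply, smul_eq_mul, innerSL_apply_apply, inner_sub_right]
    ring
  have hfA : ∀ a ∈ A, f a ≤ f y₀ := fun a ha => by
    have h1 := hmax a (hsub ha)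
    rw [hfs a]
    rcases le_or_gt (inner ℝ m (a - y₀)) 0 with h | h
    · have := mul_nonpos_of_nonneg_of_nonpos ht0 h
      linarith
    · have := hmin a ⟨ha, h⟩
      rw [le_div_iff₀ h] at this
      linarith
  have hfC : ∀ y ∈ convexHull ℝ A, f y ≤ f y₀ := fun y hy => le_of_mem_convexHull hfA hy
  have hmF : ∀ y ∈ F, inner ℝ m (y - y₀) = 0 := fun y hy => hmW _ <| Submodule.mem_sup_left <|
    sub_mem_direction_affineSpan (subset_affineSpan ℝ _ hy) (subset_affineSpan ℝ _ hy₀)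
  have hfb : f b < f y₀ := by
    rw [hfs b, hmW _ (Submodule.mem_sup_right (Submodule.mem_span_singleton_self _))]
    linarith [hlt b hbA hbF]
  refine ⟨_, isProperFace_toExposed f hy₀C hfC (hsub hbA) hfb, ?_⟩
  refine (Set.ssubset_iff_of_subset ?_).2 ⟨a₀, ⟨ha₀, fun h => ?_⟩, fun h => h.2 ⟨hsub ha₀, ?_⟩⟩
  · refine Set.sdiff_subset_sdiff_right fun y hy => ⟨hF.1.subset hy, ?_⟩
    have : f y = f y₀ := by rw [hfs y, hFl y hy, hmF y hy]; ring
    rwa [this]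
  · exact hh₀.ne' (hmF a₀ h)
  · have : f a₀ = f y₀ := by
      rw [hfs a₀, ht, div_mul_cancel₀ _ hh₀.ne']
      ring
    rwa [this]

theorem IsProperFace.exists_isFacet (hfin : A.Finite) {F : Set (EuclideanSpace ℝ (Fin d))}
    (hF : IsProperFace (convexHull ℝ A) F) : ∃ F', IsFacet (convexHull ℝ A) F' := by
  induction hn : (A \ F).ncard using Nat.strong_induction_on generalizing F with
  | _ n ih =>
  by_cases h : IsFacet (convexHull ℝ A) F
  · exact ⟨F, h⟩
  · obtain ⟨F', hF', hss⟩ := hF.exists_larger hfin h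
    exact ih _ (hn ▸ Set.ncard_lt_ncard hss (hfin.subset Set.sdiff_subset)) hF' rfl

/-- With `p` the projection of `v` on the affine hull of `F`, the vector `r = p - v` is no longer
than `q - v`. The ray bound in direction `r` gives exactly `‖r‖`. -/
theorem IsFacet.atomicFacialDist_le_dist (hfin : A.Finite) {F : Set (EuclideanSpace ℝ (Fin d))}
    (hF : IsFacet (convexHull ℝ A) F) {q v : EuclideanSpace ℝ (Fin d)} (hq : q ∈ affineSpan ℝ F)
    (hv : v ∈ A) (hvF : v ∉ F) : atomicFacialDist A ≤ dist q v := by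
  obtain ⟨y₀, hy₀⟩ := hF.2.1
  obtain ⟨l, hl⟩ := hF.1 hF.2.1
  have hsub := subset_convexHull ℝ A
  have hy₀C := hF.1.subset hy₀
  have hmax : ∀ y ∈ convexHull ℝ A, l y ≤ l y₀ := by rw [hl] at hy₀; exact hy₀.2
  have hFl : ∀ y ∈ F, l y = l y₀ := fun y hy =>
    le_antisymm (hmax y (hF.1.subset hy)) (by rw [hl] at hy; exact hy.2 _ hy₀C)
  have hlv : l v < l y₀ := lt_of_le_of_ne (hmax v (hsub hv)) fun h =>
    hvF (by rw [hl]; exact ⟨hsub hv, h ▸ hmax⟩)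
  set U := (affineSpan ℝ (convexHull ℝ A)).direction with hU
  set W := (affineSpan ℝ F).direction with hW
  have hWl : ∀ w ∈ W, l w = 0 := direction_affineSpan_le_ker hFl
  have hspan : ∀ {x}, x ∈ convexHull ℝ A → x ∈ affineSpan ℝ (convexHull ℝ A) :=
    fun hx => subset_affineSpan ℝ _ hx
  have hy₀F : y₀ ∈ affineSpan ℝ F := subset_affineSpan ℝ _ hy₀
  set p := W.starProjection (v - y₀) + y₀ with hp
  have hpF : p ∈ affineSpan ℝ F :=
    AffineSubspace.vadd_mem_of_mem_direction (W.starProjection_apply_mem _) hy₀F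
  set r := p - v with hr
  have hrW : ∀ w ∈ W, inner ℝ r w = 0 := fun w hw => by
    have := W.starProjection_inner_eq_zero (v - y₀) w hw
    rw [← neg_eq_zero, ← inner_neg_left] at this
    convert this using 2
    rw [hr, hp]
    abel
  have hWU : W ≤ U := AffineSubspace.direction_le (affineSpan_mono ℝ hF.1.subset)
  have hpy : p - y₀ ∈ W := sub_mem_direction_affineSpan hpF hy₀F
  have hlr : 0 < l r := by
    have := hWl _ hpy
    rw [map_sub] at this
    rw [hr, map_sub]
    linarith
  have hr0 : r ≠ 0 := by
    intro h
    rw [h, map_zero] at hlr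
    exact hlr.false
  have hrU : r ∈ U := by
    have h1 : p - v = (p - y₀) - (v - y₀) := by abel
    rw [hr, h1]
    exact U.sub_mem (hWU hpy) (sub_mem_direction_affineSpan (hspan (hsub hv)) (hspan hy₀C))
  -- Codimension one enters here: `r` is the only direction beyond `W`, so `⟨r, ·⟩` is maximal on
  -- `F` just as `l` is.
  have hsup : W ⊔ Submodule.span ℝ {r} = U := by
    refine Submodule.eq_of_le_of_finrank_eq (sup_le hWU ?_) ?_
    · rwa [Submodule.span_singleton_le_iff_mem]
    · rw [finrank_sup_span_singleton_eq (fun h => hlr.ne' (hWl _ h))]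
      exact hF.2.2
  have hrr : 0 < inner ℝ r r := real_inner_self_pos.2 hr0
  have hle : ∀ s ∈ convexHull ℝ A, inner ℝ r (s - y₀) ≤ 0 := by
    intro s hs
    have hsU : s - y₀ ∈ W ⊔ Submodule.span ℝ {r} :=
      hsup ▸ sub_mem_direction_affineSpan (hspan hs) (hspan hy₀C)
    obtain ⟨w, hw, _, hc, hwc⟩ := Submodule.mem_sup.1 hsU
    obtain ⟨c, rfl⟩ := Submodule.mem_span_singleton.1 hc
    have h1 : l (s - y₀) = c * l r := by rw [← hwc, map_add, hWl w hw, map_smul]; simp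
    have h2 := hmax s hs
    rw [map_sub] at h1
    have hc0 : c ≤ 0 := by
      by_contra! hc0
      have := mul_pos hc0 hlr
      linarith
    rw [← hwc, inner_add_right, hrW w hw, zero_add, inner_smul_right]
    exact mul_nonpos_of_nonpos_of_nonneg hc0 hrr.le
  have hrdist : ‖r‖ ≤ dist q v := by
    have h1 : inner ℝ r (q - v) = inner ℝ r r := by
      have h2 : q - v = (q - p) + r := by rw [hr]; abel
      rw [h2, inner_add_right, hrW _ (sub_mem_direction_affineSpan hq hpF), zero_add]
    have h3 := real_inner_le_norm r (q - v)
    rw [h1, real_inner_self_eq_norm_sq, sq] at h3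
    rw [dist_eq_norm]
    exact le_of_mul_le_mul_left h3 (norm_pos_iff.2 hr0)
  have hry : inner ℝ r (y₀ - v) = inner ℝ r r := by
    have h2 : y₀ - v = r - (p - y₀) := by rw [hr]; abel
    rw [h2, inner_sub_right, hrW _ hpy, sub_zero]
  refine le_trans ?_ hrdist
  obtain ⟨y, hy, ε, hε0, hε1, hyε⟩ := exists_lineMap_mem_of_mem_affineSpan
    (hF.1.convex (convex_convexHull ℝ A)) hF.2.1 hpF
  -- `p` may lie outside `F`, so the ray cannot simply start at `v`. Mixing `v` with `y` makes the
  -- step `ε • r` land at `(1 - ε) • y + ε • p`, which is in `F`.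
  refine atomicFacialDist_le_of_ray (K := convexHull ℝ A) (S := F ∩ A ∪ {v})
    (x := (1 - ε) • y + ε • v) hfin (IsExposed.refl _) ?_ ?_ hr0 hε0 ?_ ?_
  · rintro s (hs | rfl)
    exacts [⟨hsub hs.2, hs.2⟩, ⟨hsub hv, hv⟩]
  · have hyS : y ∈ convexHull ℝ (F ∩ A ∪ {v}) :=
      convexHull_mono Set.subset_union_left (hF.1.eq_convexHull_inter ▸ hy)
    have hvS : v ∈ convexHull ℝ (F ∩ A ∪ {v}) := subset_convexHull ℝ _ (Or.inr rfl)
    exact convex_convexHull ℝ _ hyS hvS (sub_nonneg.2 hε1.le) hε0.le (sub_add_cancel 1 ε)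
  · refine hF.1.subset ?_
    convert hyε using 1
    rw [hr]
    module
  · rintro s ⟨hs, -⟩ w hw
    refine inner_inv_norm_smul_le_norm hr0 ?_
    have h1 := hle s hs
    have h2 : s - w = (s - y₀) + (y₀ - w) := by abel
    rw [h2, inner_add_right]
    rcases hw with hw | rfl
    · rw [hrW _ (sub_mem_direction_affineSpan hy₀F (subset_affineSpan ℝ _ hw.1))]
      linarith
    · linarith

/-- The facet bound is used with the vertices as atoms; a facet must also exist, lest the infimum on
the right be `sInf ∅ = 0`. -/
theorem facialDist_le_vertexFacetDist (hfin : A.Finite) (hA : A.Nontrivial) :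
    facialDist (convexHull ℝ A) ≤ vertexFacetDist (convexHull ℝ A) := by
  obtain ⟨F₀, hF₀⟩ := exists_isProperFace hfin hA
  obtain ⟨F₁, hF₁⟩ := hF₀.exists_isFacet hfin
  refine le_csInf ⟨_, F₁, hF₁, rfl⟩ ?_
  rintro _ ⟨F, hF, rfl⟩
  have hconv := convexHull_extremePoints_convexHull hfin
  have hV : ((convexHull ℝ A).extremePoints ℝ).Finite := hfin.subset extremePoints_convexHull_subset
  have hF' : IsFacet (convexHull ℝ ((convexHull ℝ A).extremePoints ℝ)) F := by rwa [hconv]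
  rw [facialDist_convexHull_eq_atomicFacialDist_extremePoints hfin]
  refine le_setDist (hF.2.1.mono (subset_affineSpan ℝ F)) hF'.isProperFace.nonempty_diff ?_
  exact fun q hq v hv => hF'.atomicFacialDist_le_dist hV hq hv.1 hv.2

end Facets

theorem mainTheorem5 {d : ℕ} (A : Set (EuclideanSpace ℝ (Fin d)))
    (hfin : A.Finite) (hA : A.Nontrivial) :
    minwidth A ≤ atomicFacialDist A ∧
    atomicFacialDist A = pyrWidth A ∧
    pyrWidth A ≤ facialDist (convexHull ℝ A) ∧
    facialDist (convexHull ℝ A) ≤ vertexFacetDist (convexHull ℝ A) ∧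
    (A = (convexHull ℝ A).extremePoints ℝ → facialDist (convexHull ℝ A) = pyrWidth A) := by
  have heq : atomicFacialDist A = pyrWidth A :=
    (atomicFacialDist_le_pyrWidth hfin hA).antisymm (pyrWidth_le_atomicFacialDist hfin hA)
  refine ⟨minwidth_le_atomicFacialDist hfin hA, heq, heq ▸ atomicFacialDist_le_facialDist hfin hA,
    facialDist_le_vertexFacetDist hfin hA, fun hV => ?_⟩
  rw [← heq, facialDist_convexHull_eq_atomicFacialDist_extremePoints hfin, ← hV]
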